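/- Let $p,q\ge 1$ be integers. For $\mathbb{H}=\mathbb{R}$ or $\mathbb{C}$ and matrices $B_1,\dots,B_N\in\mathbb{H}^{p\times q}$, the bilinear form corresponding to $B_1,\dots,B_N$ is $L:\mathbb{H}^p\times\mathbb{H}^q\to\mathbb{H}^N$, $L(x,y)=(x^{\top}B_1y,\dots,x^{\top}B_Ny)$. It is called nonsingular if $L(x,y)=0$ implies $x=0$ or $y=0$. For a subset $S$ of $\mathbb{H}^n$, let $\dim S$ denote the Krull dimension of $\mathbb{H}[x_1,\dots,x_n]/\mathbf{I}(S)$, where $\mathbf{I}(S)$ is the ideal of all polynomials over $\mathbb{H}$ that vanish on $S$ (with $\dim\emptyset=-\infty$). (1) Let $N\ge p+q-1$ and let $r_1,\dots,r_N$ be integers with $1\le r_j\le\min\{p,q\}$ for all $j$. Let $\mathbb{H}=\mathbb{R}$ or $\mathbb{H}=\mathbb{C}$. Then, for generic $B_1,\dots,B_N\in\mathbb{H}^{p\times q}$ with $\operatorname{rank}(B_j)=r_j$ for all $j$, the bilinear form corresponding to $B_1,\dots,B_N$ is nonsingular. Precisely: let $E\subset(\mathbb{H}^{p\times q})^N$ be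 the set of all $(B_j)_{j=1}^N$ with $\operatorname{rank}(B_j)=r_j$ for all $j$. Then there is an algebraic set $Z\subset(\mathbb{H}^{p\times q})^N$ (the common zero set of a set of polynomials over $\mathbb{H}$ in the matrix entries) such that $\dim(E\cap Z)<\dim E$, and for every $(B_j)_{j=1}^N\in E\setminus Z$ the bilinear form corresponding to $B_1,\dots,B_N$ is nonsingular. (2) In particular, the minimal $N$ for which there exist $B_1,\dots,B_N\in\mathbb{R}^{p\times q}$ whose corresponding bilinear form is nonsingular, denoted $p\#q$, exists and satisfies $p\#q\le p+q-1$. -/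

import Mathlib

open scoped Matrix

noncomputable section

/-- The dimension of a subset `S` of affine space `K^σ`: the Krull dimension of its coordinate ring
`K[x] / I(S)`. Over `ℂ` this is the dimension of the Zariski closure of `S`; over `ℝ` it is the
real dimension of `S` when `S` is semialgebraic. The empty set has dimension `⊥`. -/
def affineDim {K σ : Type*} [Field K] (S : Set (σ → K)) : WithBot ℕ∞ :=
  ringKrullDim (MvPolynomial σ K ⧸ MvPolynomial.vanishingIdeal K S)

/-- `P` holds for a generic point of `E`: it holds at all points of `E` outside the zero locus of
some polynomials over `K`, and that zero locus meets `E` in a set of smaller dimension. -/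
def HoldsGenerically {K σ : Type*} [Field K] (E : Set (σ → K)) (P : (σ → K) → Prop) : Prop :=
  ∃ I : Ideal (MvPolynomial σ K),
    affineDim (E ∩ MvPolynomial.zeroLocus K I) < affineDim E ∧
      ∀ x ∈ E, x ∉ MvPolynomial.zeroLocus K I → P x

/-- The `N`-tuple of `p × q` matrices with the given list of entries. -/
def matrixTuple {K : Type*} {p q N : ℕ} (x : Fin N × Fin p × Fin q → K) :
    Fin N → Matrix (Fin p) (Fin q) K :=
  fun j => Matrix.of fun a b => x (j, a, b)

/-- All `N`-tuples of `p × q` matrices (as points of affine space) whose `j`-th member has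
rank exactly `r j`. -/
def prescribedRank (K : Type*) [Field K] (p q : ℕ) {N : ℕ} (r : Fin N → ℕ) :
    Set (Fin N × Fin p × Fin q → K) :=
  {x | ∀ j, (matrixTuple x j).rank = r j}

/-- The bilinear form `L(x, y) = (xᵀ B₁ y, …, xᵀ B_N y)` corresponding to `B₁, …, B_N`. -/
def bilinearFormOf {K : Type*} [Field K] {p q N : ℕ} (B : Fin N → Matrix (Fin p) (Fin q) K)
    (x : Fin p → K) (y : Fin q → K) : Fin N → K :=
  fun j => x ⬝ᵥ (B j *ᵥ y)

/-- The bilinear form corresponding to `B₁, …, B_N` is nonsingular. -/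
def NonsingularForm {K : Type*} [Field K] {p q N : ℕ}
    (B : Fin N → Matrix (Fin p) (Fin q) K) : Prop :=
  ∀ (x : Fin p → K) (y : Fin q → K), bilinearFormOf B x y = 0 → x = 0 ∨ y = 0

/-- The `N` for which a nonsingular real bilinear form of size `(p, q, N)` exists. -/
def nonsingularSizes (p q : ℕ) : Set ℕ :=
  {N | ∃ B : Fin N → Matrix (Fin p) (Fin q) ℝ, NonsingularForm B}

/-- `p # q`: the minimal `N` for which a nonsingular real bilinear form of size `(p, q, N)`
exists. -/
def sharpNumber (p q : ℕ) : ℕ := sInf (nonsingularSizes p q)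

end

open scoped Matrix

/-! Factoring `B_j = P_j Q_j` parametrizes E densely from an affine space, so I(E) is prime, and any
polynomial outside I(E) cuts E in smaller dimension (`affineDim_inter_zeroLocus_lt`). It remains to
find such a polynomial certifying nonsingularity (`exists_polynomial_nonsingularForm`). Since r_j ≥
1, the parametrization also reaches rank one tuples, so it suffices that the certificate is nonzero
at one of them.

Take L_j = x(t_j) y(t_j) with distinct t_j, reading x and y as polynomials of degree < p and < q = d
+ 1. As N ≥ p + d, all products of d + 1 coordinates of x and one of y are combinations of multiples
of the L_j (`prod_coeffEval_mul_monomial_mem`). A determinant records this and stays nonzero for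
generic B. -/

/-- A matrix of rank `r` is a product of matrices with inner dimension `r`. -/
theorem Matrix.exists_eq_mul_of_rank_eq {K m n : Type*} [Field K] [Finite m] [Fintype n]
    (A : Matrix m n K) {r : ℕ} (h : A.rank = r) :
    ∃ (P : Matrix m (Fin r) K) (Q : Matrix (Fin r) n K), A = P * Q := by
  classical
  have := Fintype.ofFinite m
  let b := Module.finBasisOfFinrankEq K (LinearMap.range A.mulVecLin) h
  let v : n → LinearMap.range A.mulVecLin := fun c =>
    ⟨A.mulVecLin (Pi.single c 1), LinearMap.mem_range_self _ _⟩
  refine ⟨Matrix.of fun a k => (b k : m → K) a, Matrix.of fun k c => b.repr (v c) k, ?_⟩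
  ext a c
  have h1 := congrArg (fun w : LinearMap.range A.mulVecLin => (w : m → K) a) (b.sum_repr (v c))
  simp only [Submodule.coe_sum, Submodule.coe_smul, Finset.sum_apply, Pi.smul_apply,
    smul_eq_mul] at h1
  simp only [Matrix.mul_apply, Matrix.of_apply]
  simp_rw [mul_comm ((b _ : m → K) a)]
  rw [h1]
  simp [v]

/-! ### Irreducibility of the prescribed rank set -/

section Parametrization

variable {K : Type*} [Field K] {p q N : ℕ}

/-- The generic tuple of products `P_j Q_j` with inner dimension `r j`. -/
noncomputable def productPoly (K : Type*) [Field K] (p q : ℕ) {N : ℕ} (r : Fin N → ℕ)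
    (i : Fin N × Fin p × Fin q) : MvPolynomial (Fin N × (Fin p ⊕ Fin q) × ℕ) K :=
  ∑ k ∈ Finset.range (r i.1), MvPolynomial.X (i.1, Sum.inl i.2.1, k) *
    MvPolynomial.X (i.1, Sum.inr i.2.2, k)

/-- The tuple of products `P_j Q_j` with inner dimension `r j`. -/
def productPoint (r : Fin N → ℕ) (z : Fin N × (Fin p ⊕ Fin q) × ℕ → K)
    (i : Fin N × Fin p × Fin q) : K :=
  ∑ k ∈ Finset.range (r i.1), z (i.1, Sum.inl i.2.1, k) * z (i.1, Sum.inr i.2.2, k)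

theorem eval_productPoly (r : Fin N → ℕ) (z : Fin N × (Fin p ⊕ Fin q) × ℕ → K)
    (i : Fin N × Fin p × Fin q) :
    MvPolynomial.eval z (productPoly K p q r i) = productPoint r z i := by
  simp [productPoly, productPoint]

theorem eval_bind_productPoly (r : Fin N → ℕ) (z : Fin N × (Fin p ⊕ Fin q) × ℕ → K)
    (f : MvPolynomial (Fin N × Fin p × Fin q) K) :
    MvPolynomial.eval z (MvPolynomial.bind₁ (productPoly K p q r) f) =
      MvPolynomial.eval (productPoint r z) f := by
  have h : (fun i => MvPolynomial.eval z (productPoly K p q r i)) = productPoint r z :=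
    funext (eval_productPoly r z)
  rw [← MvPolynomial.coe_aeval_eq_eval, ← MvPolynomial.coe_aeval_eq_eval, RingHom.coe_coe,
    RingHom.coe_coe, MvPolynomial.aeval_bind₁]
  simp only [MvPolynomial.aeval_eq_eval, h]

theorem rank_productPoint_le (r : Fin N → ℕ) (z : Fin N × (Fin p ⊕ Fin q) × ℕ → K) (j : Fin N) :
    (matrixTuple (productPoint r z) j).rank ≤ r j := by
  have h : matrixTuple (productPoint r z) j =
      (Matrix.of fun (a : Fin p) (k : Fin (r j)) => z (j, Sum.inl a, (k : ℕ))) *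
        Matrix.of fun (k : Fin (r j)) (b : Fin q) => z (j, Sum.inr b, (k : ℕ)) := by
    ext a b
    simp [matrixTuple, productPoint, Matrix.mul_apply, Finset.sum_range]
  rw [h]
  exact (Matrix.rank_mul_le_left _ _).trans (Matrix.rank_le_width _)

theorem exists_productPoint_eq {r : Fin N → ℕ} {x : Fin N × Fin p × Fin q → K}
    (hx : x ∈ prescribedRank K p q r) :
    ∃ z : Fin N × (Fin p ⊕ Fin q) × ℕ → K, productPoint r z = x := by
  choose P Q h using fun j => Matrix.exists_eq_mul_of_rank_eq _ (hx j)
  -- The padding value 0 is immaterial: only indices k < r j enter `productPoint`.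
  refine ⟨fun i => if hk : i.2.2 < r i.1 then
    Sum.elim (fun a => P i.1 a ⟨_, hk⟩) (fun b => Q i.1 ⟨_, hk⟩ b) i.2.1 else 0, ?_⟩
  ext ⟨j, a, b⟩
  have h1 := congrFun (congrFun (h j) a) b
  simp only [matrixTuple, Matrix.of_apply, Matrix.mul_apply] at h1
  simp [productPoint, h1, Finset.sum_range]

/-- The leading `r j × r j` minor of the `j`-th generic product. -/
noncomputable def leadingMinor {r : Fin N → ℕ} (hr : ∀ j, r j ≤ min p q) (j : Fin N) :
    MvPolynomial (Fin N × (Fin p ⊕ Fin q) × ℕ) K :=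
  Matrix.det (Matrix.of fun i i' : Fin (r j) => productPoly K p q r
    (j, Fin.castLE ((hr j).trans (min_le_left _ _)) i,
      Fin.castLE ((hr j).trans (min_le_right _ _)) i'))

theorem eval_leadingMinor {r : Fin N → ℕ} (hr : ∀ j, r j ≤ min p q) (j : Fin N)
    (z : Fin N × (Fin p ⊕ Fin q) × ℕ → K) :
    MvPolynomial.eval z (leadingMinor hr j) =
      ((matrixTuple (productPoint r z) j).submatrix
        (Fin.castLE ((hr j).trans (min_le_left _ _)))
        (Fin.castLE ((hr j).trans (min_le_right _ _)))).det := by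
  rw [leadingMinor, RingHom.map_det]
  congr 1
  ext i i'
  simp [matrixTuple, eval_productPoly]

theorem leadingMinor_ne_zero {r : Fin N → ℕ} (hr : ∀ j, r j ≤ min p q) (j : Fin N) :
    leadingMinor (K := K) hr j ≠ 0 := by
  intro h
  -- Both factors are truncated identity matrices, so the minor evaluates to det 1.
  have h1 := eval_leadingMinor hr j (K := K) fun i =>
    Sum.elim (fun a : Fin p => if (a : ℕ) = i.2.2 then 1 else 0)
      (fun b : Fin q => if (b : ℕ) = i.2.2 then 1 else 0) i.2.1
  rw [h, map_zero] at h1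
  refine one_ne_zero (α := K) ?_
  rw [h1, ← Matrix.det_one (n := Fin (r j))]
  congr 1
  ext i i'
  simp [matrixTuple, productPoint, Matrix.one_apply, Fin.ext_iff]

theorem productPoint_mem {r : Fin N → ℕ} (hr : ∀ j, r j ≤ min p q)
    {z : Fin N × (Fin p ⊕ Fin q) × ℕ → K}
    (hz : ∀ j, MvPolynomial.eval z (leadingMinor hr j) ≠ 0) :
    productPoint r z ∈ prescribedRank K p q r := by
  intro j
  refine le_antisymm (rank_productPoint_le r z j) ?_
  have h := hz j
  rw [eval_leadingMinor] at h
  refine le_of_eq_of_le ?_ (Matrix.rank_submatrix_le (matrixTuple (productPoint r z) j)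
    (Fin.castLE ((hr j).trans (min_le_left _ _))) (Fin.castLE ((hr j).trans (min_le_right _ _))))
  rw [Matrix.rank_of_det_ne_zero h, Fintype.card_fin]

/-- Products have rank r j wherever the leading minors are nonzero. If f vanishes on E, its pullback
times all these minors vanishes everywhere, hence is zero over an infinite field, and the minors
cancel. -/
theorem mem_vanishingIdeal_prescribedRank_iff [Infinite K] {r : Fin N → ℕ}
    (hr : ∀ j, r j ≤ min p q) (f : MvPolynomial (Fin N × Fin p × Fin q) K) :
    f ∈ MvPolynomial.vanishingIdeal K (prescribedRank K p q r) ↔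
      MvPolynomial.bind₁ (productPoly K p q r) f = 0 := by
  simp only [MvPolynomial.mem_vanishingIdeal_iff, MvPolynomial.aeval_eq_eval]
  constructor
  · intro h
    have h0 : MvPolynomial.bind₁ (productPoly K p q r) f * ∏ j, leadingMinor hr j = 0 := by
      refine MvPolynomial.funext fun z => ?_
      rw [map_mul, map_prod, map_zero, eval_bind_productPoly, mul_eq_zero]
      by_contra! hne
      exact hne.1 (h _ (productPoint_mem hr fun j => Finset.prod_ne_zero_iff.1 hne.2 j (by simp)))
    exact (mul_eq_zero.1 h0).resolve_right
      (Finset.prod_ne_zero_iff.2 fun j _ => leadingMinor_ne_zero hr j)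
  · intro h x hx
    obtain ⟨z, rfl⟩ := exists_productPoint_eq hx
    simpa [h] using (eval_bind_productPoly r z f).symm

theorem isPrime_vanishingIdeal_prescribedRank [Infinite K] {r : Fin N → ℕ}
    (hr : ∀ j, r j ≤ min p q) :
    (MvPolynomial.vanishingIdeal K (prescribedRank K p q r)).IsPrime := by
  have h : MvPolynomial.vanishingIdeal K (prescribedRank K p q r) =
      RingHom.ker (MvPolynomial.bind₁ (productPoly K p q r)) := by
    ext f
    rw [mem_vanishingIdeal_prescribedRank_iff hr, RingHom.mem_ker]
  rw [h]
  exact RingHom.ker_isPrime _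

end Parametrization

/-! ### Dimension drop -/

/-- A polynomial not vanishing on a set with prime vanishing ideal cuts out a subset of smaller
dimension. -/
theorem affineDim_inter_zeroLocus_lt {K σ : Type*} [Field K] [Finite σ] {E : Set (σ → K)}
    (hE : (MvPolynomial.vanishingIdeal K E).IsPrime) {f : MvPolynomial σ K}
    (hf : f ∉ MvPolynomial.vanishingIdeal K E) :
    affineDim (E ∩ MvPolynomial.zeroLocus K (Ideal.span {f})) < affineDim E := by
  set J := MvPolynomial.vanishingIdeal K E
  set J' := MvPolynomial.vanishingIdeal K (E ∩ MvPolynomial.zeroLocus K (Ideal.span {f}))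
  have hJ : J ≤ J' := MvPolynomial.vanishingIdeal_anti_mono Set.inter_subset_left
  have hfJ : f ∈ J' := fun x hx => hx.2 f (Ideal.mem_span_singleton_self f)
  have h1 : ringKrullDim (MvPolynomial σ K ⧸ J') + 1 ≤ ringKrullDim (MvPolynomial σ K ⧸ J) := by
    refine ringKrullDim_succ_le_of_surjective (Ideal.Quotient.factor hJ)
      (Ideal.Quotient.factor_surjective hJ) (r := Ideal.Quotient.mk J f) ?_ ?_
    · rw [mem_nonZeroDivisors_iff_ne_zero, Ne, Ideal.Quotient.eq_zero_iff_mem]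
      exact hf
    · rw [Ideal.Quotient.factor_mk, Ideal.Quotient.eq_zero_iff_mem]
      exact hfJ
  -- Finiteness is needed to turn dim + 1 ≤ dim into a strict inequality.
  have h2 : ringKrullDim (MvPolynomial σ K ⧸ J) < ⊤ := by
    refine (ringKrullDim_quotient_le J).trans_lt ?_
    have := Fintype.ofFinite σ
    rw [MvPolynomial.ringKrullDim_of_isNoetherianRing, ringKrullDim_eq_zero_of_field]
    simp
    exact WithBot.coe_lt_coe.2 (ENat.natCast_lt_top _)
  have := Ideal.Quotient.nontrivial_iff.2 hE.ne_top
  have h3 : 0 ≤ ringKrullDim (MvPolynomial σ K ⧸ J) := ringKrullDim_nonneg_of_nontrivial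
  change ringKrullDim (MvPolynomial σ K ⧸ J') < ringKrullDim (MvPolynomial σ K ⧸ J)
  generalize ringKrullDim (MvPolynomial σ K ⧸ J') = d' at *
  generalize ringKrullDim (MvPolynomial σ K ⧸ J) = d at *
  induction d' with
  | bot => exact (WithBot.bot_lt_coe _).trans_le h3
  | coe d' =>
    lift d to ℕ∞ using (WithBot.bot_lt_coe _).trans_le h3 |>.ne'
    rw [← WithBot.coe_top, WithBot.coe_lt_coe] at h2
    rw [← WithBot.coe_one, ← WithBot.coe_add, WithBot.coe_le_coe] at h1
    rw [WithBot.coe_lt_coe]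
    have h4 : d' ≠ ⊤ := by
      rintro rfl
      exact h2.not_ge (by simpa using h1)
    exact (ENat.add_one_le_iff h4).1 h1

/-! ### The certificate from a rank one tuple -/

section RankOne

variable {K : Type*} [Field K] {p d N : ℕ}

/-- The value at `t` of the polynomial with coefficients `x`. -/
def coeffEval {n : ℕ} (t : K) (x : Fin n → K) : K := ∑ k : Fin n, t ^ (k : ℕ) * x k

/-- Interpolation: a polynomial of degree < n is determined by its values at n distinct nodes, by
inverting a Vandermonde matrix. -/
theorem exists_coeff_eq_sum_coeffEval {n : ℕ} {t : Fin N → K} (ht : Function.Injective t)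
    {T : Finset (Fin N)} (hT : n ≤ T.card) (a : Fin n) :
    ∃ (e : Fin n → Fin N) (c : Fin n → K), (∀ i, e i ∈ T) ∧
      ∀ x : Fin n → K, x a = ∑ i, c i * coeffEval (t (e i)) x := by
  let e := T.orderEmbOfCardLe hT
  let V := Matrix.vandermonde (t ∘ e)
  have hV : IsUnit V.det :=
    (Matrix.det_vandermonde_ne_zero_iff.2 (ht.comp e.injective)).isUnit
  refine ⟨e, V⁻¹ a, T.orderEmbOfCardLe_mem hT, fun x => ?_⟩
  have h : V⁻¹ *ᵥ (V *ᵥ x) = x := by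
    rw [Matrix.mulVec_mulVec, Matrix.nonsing_inv_mul _ hV, Matrix.one_mulVec]
  exact (congrFun h a).symm

theorem prod_linear_mem_span_monomial {ι : Type*} (u : ι → Fin p → K) {T : Finset ι}
    (hT : T.card = d) :
    (fun x : Fin p → K => ∏ j ∈ T, ∑ a, u j a * x a) ∈
      Submodule.span K (Set.range fun (v : Fin d → Fin p) (x : Fin p → K) => ∏ i, x (v i)) := by
  let e := T.equivFinOfCardEq hT
  have h : (fun x : Fin p → K => ∏ j ∈ T, ∑ a, u j a * x a) =
      ∑ v : Fin d → Fin p, (∏ i, u (e.symm i) (v i)) • fun x : Fin p → K => ∏ i, x (v i) := by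
    ext x
    rw [← Finset.prod_coe_sort, ← e.symm.prod_comp, Finset.prod_univ_sum]
    simp [Finset.sum_apply, Finset.prod_mul_distrib]
  rw [h]
  exact Submodule.sum_mem _ fun v _ => Submodule.smul_mem _ _ (Submodule.subset_span ⟨v, rfl⟩)

/-- The span of the multiples of the bilinear functions `x(t_j) y(t_j)` by monomials of degree `d`
in `x`. -/
def evalIdealPart (p q d : ℕ) (t : Fin N → K) :
    Submodule K ((Fin p → K) × (Fin q → K) → K) :=
  Submodule.span K (Set.range fun (s : Fin N × (Fin d → Fin p)) (z : (Fin p → K) × (Fin q → K)) =>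
    (∏ i, z.1 (s.2 i)) * (coeffEval (t s.1) z.1 * coeffEval (t s.1) z.2))

theorem prod_coeffEval_mul_mem {q : ℕ} (t : Fin N → K) {T : Finset (Fin N)} (hT : T.card = d)
    (j : Fin N) :
    (fun z : (Fin p → K) × (Fin q → K) => (∏ i ∈ T, coeffEval (t i) z.1) *
      (coeffEval (t j) z.1 * coeffEval (t j) z.2)) ∈ evalIdealPart p q d t := by
  let M : ((Fin p → K) → K) →ₗ[K] ((Fin p → K) × (Fin q → K) → K) :=
    { toFun := fun g z => g z.1 * (coeffEval (t j) z.1 * coeffEval (t j) z.2)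
      map_add' := fun g h => by ext z; simp [add_mul]
      map_smul' := fun c g => by ext z; simp [mul_assoc] }
  have h := Submodule.mem_map_of_mem (f := M)
    (prod_linear_mem_span_monomial (fun i (a : Fin p) => t i ^ (a : ℕ)) hT)
  refine (Submodule.map_span_le M _ _).2 ?_ h
  rintro _ ⟨v, rfl⟩
  exact Submodule.subset_span ⟨(j, v), rfl⟩

/-- The k remaining coordinates of x are traded one by one for values x(t_j) at new nodes. Once S
has d + 1 nodes, y_b is interpolated from them, and each term contains some x(t_j) y(t_j) with j in
S. -/
theorem prod_coeffEval_mul_monomial_mem {t : Fin N → K} (ht : Function.Injective t)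
    (hN : p + d ≤ N) (b : Fin (d + 1)) (k : ℕ) :
    ∀ (w : Fin k → Fin p) (S : Finset (Fin N)), S.card + k = d + 1 →
      (fun z : (Fin p → K) × (Fin (d + 1) → K) =>
        (∏ j ∈ S, coeffEval (t j) z.1) * ((∏ i, z.1 (w i)) * z.2 b)) ∈
        evalIdealPart p (d + 1) d t := by
  induction k with
  | zero =>
    intro w S hS
    obtain ⟨e, c, he, hc⟩ := exists_coeff_eq_sum_coeffEval ht (T := S) (by omega) b
    have h : (fun z : (Fin p → K) × (Fin (d + 1) → K) =>
        (∏ j ∈ S, coeffEval (t j) z.1) * ((∏ i, z.1 (w i)) * z.2 b)) =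
        ∑ i, c i • fun z : (Fin p → K) × (Fin (d + 1) → K) =>
          (∏ j ∈ S.erase (e i), coeffEval (t j) z.1) *
            (coeffEval (t (e i)) z.1 * coeffEval (t (e i)) z.2) := by
      ext z
      rw [hc z.2]
      simp only [Finset.univ_eq_empty, Finset.prod_empty, one_mul, Finset.mul_sum,
        Finset.sum_apply, Pi.smul_apply, smul_eq_mul]
      refine Finset.sum_congr rfl fun i _ => ?_
      rw [← Finset.mul_prod_erase S _ (he i)]
      ring
    rw [h]
    refine Submodule.sum_mem _ fun i _ => Submodule.smul_mem _ _ (prod_coeffEval_mul_mem t ?_ _)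
    rw [Finset.card_erase_of_mem (he i)]
    omega
  | succ k ih =>
    intro w S hS
    -- Here S has at most d elements, so at least p nodes remain unused.
    obtain ⟨e, c, he, hc⟩ := exists_coeff_eq_sum_coeffEval ht (n := p) (T := Sᶜ)
      (by rw [Finset.card_compl, Fintype.card_fin]; omega) (w 0)
    have h : (fun z : (Fin p → K) × (Fin (d + 1) → K) =>
        (∏ j ∈ S, coeffEval (t j) z.1) * ((∏ i, z.1 (w i)) * z.2 b)) =
        ∑ i, c i • fun z : (Fin p → K) × (Fin (d + 1) → K) =>
          (∏ j ∈ insert (e i) S, coeffEval (t j) z.1) *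
            ((∏ l, z.1 (Fin.tail w l)) * z.2 b) := by
      ext z
      rw [Fin.prod_univ_succ, hc z.1]
      simp only [Finset.mul_sum, Finset.sum_mul, Finset.sum_apply, Pi.smul_apply, smul_eq_mul]
      refine Finset.sum_congr rfl fun i _ => ?_
      rw [Finset.prod_insert (Finset.mem_compl.1 (he i))]
      simp only [Fin.tail]
      ring
    rw [h]
    refine Submodule.sum_mem _ fun i _ => Submodule.smul_mem _ _ (ih _ _ ?_)
    rw [Finset.card_insert_of_notMem (Finset.mem_compl.1 (he i))]
    omega

theorem exists_monomial_eq_sum {t : Fin N → K} (ht : Function.Injective t) (hN : p + d ≤ N)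
    (s : (Fin (d + 1) → Fin p) × Fin (d + 1)) :
    ∃ c : Fin N × (Fin d → Fin p) → K, ∀ (x : Fin p → K) (y : Fin (d + 1) → K),
      (∏ i, x (s.1 i)) * y s.2 =
        ∑ u, c u * ((∏ i, x (u.2 i)) * (coeffEval (t u.1) x * coeffEval (t u.1) y)) := by
  have h := prod_coeffEval_mul_monomial_mem ht hN s.2 (d + 1) s.1 ∅ (by simp)
  obtain ⟨c, hc⟩ := (Submodule.mem_span_range_iff_exists_fun K).1 h
  refine ⟨c, fun x y => ?_⟩
  simpa [Finset.sum_apply] using (congrFun hc (x, y)).symm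

/-- The tuple of rank one matrices `(t_j ^ (a + b))`. -/
def vandermondeTuple (p q : ℕ) (t : Fin N → K) (i : Fin N × Fin p × Fin q) : K :=
  t i.1 ^ (i.2.1 : ℕ) * t i.1 ^ (i.2.2 : ℕ)

theorem bilinearFormOf_matrixTuple {q : ℕ} (B : Fin N × Fin p × Fin q → K) (x : Fin p → K)
    (y : Fin q → K) (j : Fin N) :
    bilinearFormOf (matrixTuple B) x y j = ∑ a, ∑ b, B (j, a, b) * (x a * y b) := by
  simp only [bilinearFormOf, matrixTuple, dotProduct, Matrix.mulVec, Matrix.of_apply,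
    Finset.mul_sum]
  exact Finset.sum_congr rfl fun a _ => Finset.sum_congr rfl fun b _ => by ring

theorem bilinearFormOf_vandermondeTuple {q : ℕ} (t : Fin N → K) (x : Fin p → K)
    (y : Fin q → K) (j : Fin N) :
    bilinearFormOf (matrixTuple (vandermondeTuple p q t)) x y j =
      coeffEval (t j) x * coeffEval (t j) y := by
  rw [bilinearFormOf_matrixTuple, coeffEval, coeffEval, Finset.sum_mul_sum]
  exact Finset.sum_congr rfl fun a _ => Finset.sum_congr rfl fun b _ => by
    simp only [vandermondeTuple]; ring

/-- The matrix expressing `∑ c_{s,j,v} x^v L_j(x, y)` in the monomials `x^w y_b`, where `L` is the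
bilinear form of `B`. -/
def macaulayMatrix {R : Type*} [CommRing R] (c : (Fin (d + 1) → Fin p) × Fin (d + 1) →
    Fin N × (Fin d → Fin p) → R) (B : Fin N × Fin p × Fin (d + 1) → R) :
    Matrix ((Fin (d + 1) → Fin p) × Fin (d + 1)) ((Fin (d + 1) → Fin p) × Fin (d + 1)) R :=
  Matrix.of fun s s' => ∑ j, c s (j, Fin.tail s'.1) * B (j, s'.1 0, s'.2)

theorem macaulayMatrix_mulVec (c : (Fin (d + 1) → Fin p) × Fin (d + 1) →
    Fin N × (Fin d → Fin p) → K) (B : Fin N × Fin p × Fin (d + 1) → K)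
    (x : Fin p → K) (y : Fin (d + 1) → K) (s : (Fin (d + 1) → Fin p) × Fin (d + 1)) :
    (macaulayMatrix c B *ᵥ fun s' => (∏ i, x (s'.1 i)) * y s'.2) s =
      ∑ u, c s u * ((∏ i, x (u.2 i)) * bilinearFormOf (matrixTuple B) x y u.1) := by
  simp only [Matrix.mulVec, dotProduct, macaulayMatrix, Matrix.of_apply, bilinearFormOf_matrixTuple,
    Fintype.sum_prod_type, Finset.sum_mul, Finset.mul_sum]
  rw [← (Fin.consEquiv fun _ : Fin (d + 1) => Fin p).sum_comp, Fintype.sum_prod_type]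
  have htail : ∀ u : Fin p × (Fin d → Fin p),
      Fin.tail ((Fin.consEquiv fun _ : Fin (d + 1) => Fin p) u) = u.2 := fun _ => rfl
  simp only [htail, Fin.consEquiv_apply, Fin.prod_univ_succ, Fin.cons_zero, Fin.cons_succ]
  rw [Finset.sum_comm]
  conv_rhs => rw [Finset.sum_comm]
  refine Finset.sum_congr rfl fun v _ => ?_
  conv_rhs => rw [Finset.sum_comm]
  refine Finset.sum_congr rfl fun a _ => ?_
  rw [Finset.sum_comm]
  exact Finset.sum_congr rfl fun j _ => Finset.sum_congr rfl fun b _ => by ring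

/-- Some polynomial in the matrix entries certifies nonsingularity, and it does not vanish at the
tuple of rank one matrices `(t_j ^ (a + b))`. -/
theorem exists_polynomial_nonsingularForm {t : Fin N → K} (ht : Function.Injective t)
    (hN : p + d ≤ N) :
    ∃ f : MvPolynomial (Fin N × Fin p × Fin (d + 1)) K,
      MvPolynomial.eval (vandermondeTuple p (d + 1) t) f ≠ 0 ∧
      ∀ B, MvPolynomial.eval B f ≠ 0 → NonsingularForm (matrixTuple B) := by
  choose c hc using exists_monomial_eq_sum (p := p) ht hN
  let f : MvPolynomial (Fin N × Fin p × Fin (d + 1)) K :=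
    -- Rows and columns are indexed by ordered words, so the matrix at the rank one tuple need not
    -- be 1, though it fixes every vector of monomial values. Adding 1 and subtracting it gives
    -- determinant 1 at that tuple, and the correction still kills monomial vectors.
    (1 + macaulayMatrix (fun s u => MvPolynomial.C (c s u)) MvPolynomial.X -
      (macaulayMatrix c (vandermondeTuple p (d + 1) t)).map MvPolynomial.C).det
  have hf : ∀ B, MvPolynomial.eval B f =
      (1 + macaulayMatrix c B - macaulayMatrix c (vandermondeTuple p (d + 1) t)).det := by
    intro B
    rw [RingHom.map_det]
    congr 1
    ext s s'
    simp [macaulayMatrix, Matrix.one_apply, apply_ite]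
  refine ⟨f, by simp [hf], fun B hB x y hxy => ?_⟩
  rw [hf] at hB
  have h0 : (fun s : (Fin (d + 1) → Fin p) × Fin (d + 1) => (∏ i, x (s.1 i)) * y s.2) = 0 := by
    refine Matrix.eq_zero_of_mulVec_eq_zero hB ?_
    ext s
    rw [Matrix.sub_mulVec, Matrix.add_mulVec, Matrix.one_mulVec, Pi.sub_apply, Pi.add_apply,
      macaulayMatrix_mulVec, macaulayMatrix_mulVec, hxy, hc s]
    simp [bilinearFormOf_vandermondeTuple]
  by_contra! hne
  obtain ⟨a, ha⟩ := Function.ne_iff.1 hne.1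
  obtain ⟨b, hb⟩ := Function.ne_iff.1 hne.2
  -- The entry for the monomial x_a ^ (d + 1) y_b.
  have h1 := congrFun h0 (fun _ => a, b)
  simp only [Finset.prod_const, Pi.zero_apply, mul_eq_zero] at h1
  exact h1.elim (pow_ne_zero _ ha) hb

end RankOne

section Main

variable {K : Type*} [Field K] {p d N : ℕ}

theorem exists_productPoint_eq_vandermondeTuple {q : ℕ} {r : Fin N → ℕ} (hr : ∀ j, 1 ≤ r j)
    (t : Fin N → K) :
    ∃ z : Fin N × (Fin p ⊕ Fin q) × ℕ → K, productPoint r z = vandermondeTuple p q t := by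
  refine ⟨fun i => if i.2.2 = 0 then
    Sum.elim (fun a : Fin p => t i.1 ^ (a : ℕ)) (fun b : Fin q => t i.1 ^ (b : ℕ)) i.2.1 else 0, ?_⟩
  ext ⟨j, a, b⟩
  have h : 0 < r j := hr j
  simp [productPoint, vandermondeTuple, h]

theorem exists_injective_fin (K : Type*) [Infinite K] (N : ℕ) :
    ∃ t : Fin N → K, Function.Injective t :=
  ⟨fun j => Infinite.natEmbedding K j,
    fun _ _ h => Fin.ext ((Infinite.natEmbedding K).injective h)⟩

theorem holdsGenerically_nonsingularForm [Infinite K] (hN : p + d ≤ N) {r : Fin N → ℕ}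
    (hr : ∀ j, 1 ≤ r j ∧ r j ≤ min p (d + 1)) :
    HoldsGenerically (prescribedRank K p (d + 1) r) fun x => NonsingularForm (matrixTuple x) := by
  obtain ⟨t, ht⟩ := exists_injective_fin K N
  obtain ⟨f, hf, hB⟩ := exists_polynomial_nonsingularForm (p := p) ht hN
  have hr' := fun j => (hr j).2
  have hfE : f ∉ MvPolynomial.vanishingIdeal K (prescribedRank K p (d + 1) r) := by
    rw [mem_vanishingIdeal_prescribedRank_iff hr']
    -- The rank one tuple need not lie in E, but it lies in the image of the parametrization, where
    -- every member of I(E) vanishes.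
    intro h
    obtain ⟨z, hz⟩ := exists_productPoint_eq_vandermondeTuple (p := p) (q := d + 1)
      (fun j => (hr j).1) t
    refine hf ?_
    rw [← hz, ← eval_bind_productPoly, h, map_zero]
  refine ⟨Ideal.span {f},
    affineDim_inter_zeroLocus_lt (isPrime_vanishingIdeal_prescribedRank hr') hfE,
    fun x _ hx => hB x fun h0 => hx ?_⟩
  rw [MvPolynomial.zeroLocus_span]
  rintro _ rfl
  simpa [MvPolynomial.aeval_eq_eval] using h0

theorem mem_nonsingularSizes (p d : ℕ) : p + d ∈ nonsingularSizes p (d + 1) := by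
  obtain ⟨t, ht⟩ := exists_injective_fin ℝ (p + d)
  obtain ⟨f, hf, hB⟩ := exists_polynomial_nonsingularForm (p := p) (d := d) ht le_rfl
  exact ⟨_, hB _ hf⟩

end Main

theorem mainTheorem5 (p q : ℕ) (hp : 1 ≤ p) (hq : 1 ≤ q) :
    (∀ N : ℕ, p + q - 1 ≤ N → ∀ r : Fin N → ℕ, (∀ j, 1 ≤ r j ∧ r j ≤ min p q) →
      HoldsGenerically (prescribedRank ℝ p q r) (fun x => NonsingularForm (matrixTuple x)) ∧
      HoldsGenerically (prescribedRank ℂ p q r) (fun x => NonsingularForm (matrixTuple x))) ∧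
    IsLeast (nonsingularSizes p q) (sharpNumber p q) ∧ sharpNumber p q ≤ p + q - 1 := by
  obtain ⟨d, rfl⟩ : ∃ d, q = d + 1 := ⟨q - 1, by omega⟩
  have h := mem_nonsingularSizes p d
  exact ⟨fun N hN r hr => ⟨holdsGenerically_nonsingularForm (by omega) hr,
    holdsGenerically_nonsingularForm (by omega) hr⟩,
    ⟨Nat.sInf_mem ⟨_, h⟩, fun _ => Nat.sInf_le⟩, Nat.sInf_le h⟩
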